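/- Write $\mathbb{C}^{2\otimes n}=(\mathbb{C}^2)^{\otimes n}$ with computational basis $|x\rangle=|x_1\rangle\otimes\cdots\otimes|x_n\rangle$, $x\in\{0,1\}^n$. For $1\le i\le n$, the single deletion error $D_i$ is the partial trace over the $i$-th qubit, mapping matrices on $\mathbb{C}^{2\otimes n}$ to matrices on $\mathbb{C}^{2\otimes(n-1)}$. A linear subspace $Q\subseteq\mathbb{C}^{2\otimes n}$ is called an $[n,k]$ single quantum deletion error-correcting code if there are a complex linear bijection $\mathrm{Enc}:\mathbb{C}^{2\otimes k}\to Q$ and a quantum operation (completely positive trace-preserving linear map) $\mathrm{Dec}$ from matrices on $\mathbb{C}^{2\otimes(n-1)}$ to matrices on $\mathbb{C}^{2\otimes k}$ such that, for every unit vector $|\phi\rangle\in\mathbb{C}^{2\otimes k}$ and every $1\le i\le n$, writing $|\Phi\rangle=\mathrm{Enc}|\phi\rangle$, $$\mathrm{Dec}\bigl(D_i(|\Phi\rangle\langle\Phi|)\bigr)=|\phi\rangle\langle\phi| .$$ Let $Q_4\subseteq\mathbb{C}^{2\otimes4}$ be the image of the linear map $$\alpha|0\rangle+\beta|1\rangle\;\mapsto\;\tfrac{\alpha}{\sqrt2}\bigl(|0000\rangle+|1111\rangle\bigr)+\tfrac{\beta}{\sqrt6}\bigl(|0011\rangle+|0101\rangle+|0110\rangle+|1001\rangle+|1010\rangle+|1100\rangle\bigr).$$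 **Theorem.** 1. Every $[n,k]$ single quantum deletion error-correcting code with $k\ge1$ has length $n\ge4$ (in particular, there is none of length $2$ or $3$). 2. $Q_4$ is a $[4,1]$ single quantum deletion error-correcting code. 3. Consequently, $4$ is the least length of a single quantum deletion error-correcting code that encodes one qubit, and it is attained by $Q_4$. -/

import Mathlib

/-- The state space `(ℂ²)^{⊗ n}` of `n` qubits, in coordinates: a vector is the family of its
amplitudes on the computational basis, which is indexed by the binary sequences of length `n`. -/
abbrev Qubits (n : ℕ) : Type := EuclideanSpace ℂ (Fin n → Fin 2)

/-- Square matrices acting on `(ℂ²)^{⊗ n}`. -/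
abbrev QubitMatrix (n : ℕ) : Type := Matrix (Fin n → Fin 2) (Fin n → Fin 2) ℂ

/-- The computational basis vector `|x⟩ = |x₁⟩ ⊗ ⋯ ⊗ |xₙ⟩`. -/
noncomputable def ket {n : ℕ} (x : Fin n → Fin 2) : Qubits n := EuclideanSpace.single x 1

/-- The matrix `|ψ⟩⟨ψ|`; for a unit vector `ψ` it is the density matrix of the pure state `ψ`. -/
noncomputable def pureState {n : ℕ} (ψ : Qubits n) : QubitMatrix n :=
  Matrix.of fun x y => ψ x * star (ψ y)

/-- Classical deletion: `x₁ … xₙ ↦ x₁ … xᵢ₋₁ xᵢ₊₁ … xₙ` (positions are counted from `0`). -/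
def deleteAt {n : ℕ} (i : Fin n) (x : Fin n → Fin 2) : Fin (n - 1) → Fin 2 := fun j =>
  if j.val < i.val then x ⟨j.val, by have := j.isLt; omega⟩
  else x ⟨j.val + 1, by have := j.isLt; omega⟩

/-- The single quantum deletion error `D_i = Tr_i`, the partial trace over the `i`-th qubit:
`∑ a_{x,y} |x⟩⟨y| ↦ ∑ a_{x,y} Tr(|x_i⟩⟨y_i|) |x with x_i removed⟩⟨y with y_i removed|`. -/
noncomputable def deletion {n : ℕ} (i : Fin n) (A : QubitMatrix n) : QubitMatrix (n - 1) :=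
  ∑ x : Fin n → Fin 2, ∑ y : Fin n → Fin 2,
    (A x y * (Matrix.single (x i) (y i) (1 : ℂ)).trace) •
      Matrix.single (deleteAt i x) (deleteAt i y) (1 : ℂ)

section

open scoped CStarAlgebra MatrixOrder Matrix.Norms.L2Operator

/-- A quantum operation (quantum channel) from `m` qubits to `n` qubits: a completely positive,
trace-preserving linear map. Here matrices carry the Loewner order (`A ≤ B` iff `B - A` is positive
semidefinite) and the L2 operator norm. -/
structure QuantumOperation (m n : ℕ) where
  toCP : QubitMatrix m →CP QubitMatrix n
  trace_map : ∀ A : QubitMatrix m, (toCP A).trace = A.trace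

/-- The action of a quantum operation on matrices, in particular on density matrices. -/
noncomputable def QuantumOperation.apply {m n : ℕ} (Φ : QuantumOperation m n) (A : QubitMatrix m) :
    QubitMatrix n :=
  Φ.toCP A

end

/-- `Q ⊆ (ℂ²)^{⊗ n}` is an `[n, k]` single deletion error-correcting code: there are a linear
bijection `Enc : (ℂ²)^{⊗ k} → Q` and a quantum operation `Dec` from `n - 1` to `k` qubits which
recovers every pure state `φ` from its encoding after the deletion of any one qubit.
(For `1 ≤ n` the last condition forces `Enc` to be isometric, as `Dec` and `D_i` preserve traces.) -/
def IsSingleDeletionCode (n k : ℕ) (Q : Submodule ℂ (Qubits n)) : Prop :=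
  ∃ (Enc : Qubits k ≃ₗ[ℂ] Q) (Dec : QuantumOperation (n - 1) k),
    ∀ φ : Qubits k, ‖φ‖ = 1 → ∀ i : Fin n,
      Dec.apply (deletion i (pureState (Enc φ : Qubits n))) = pureState φ

/-- The encoder of the four-qubit code,
`α|0⟩ + β|1⟩ ↦ (α/√2)(|0000⟩ + |1111⟩)
  + (β/√6)(|0011⟩ + |0101⟩ + |0110⟩ + |1001⟩ + |1010⟩ + |1100⟩)`. -/
noncomputable def En4 : Qubits 1 →ₗ[ℂ] Qubits 4 where
  toFun φ :=
    (φ ![0] / (√2 : ℝ)) • (ket ![0, 0, 0, 0] + ket ![1, 1, 1, 1]) +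
    (φ ![1] / (√6 : ℝ)) •
      (ket ![0, 0, 1, 1] + ket ![0, 1, 0, 1] + ket ![0, 1, 1, 0] +
        ket ![1, 0, 0, 1] + ket ![1, 0, 1, 0] + ket ![1, 1, 0, 0])
  map_add' φ ψ := by
    simp only [PiLp.add_apply, add_div, add_smul]
    abel
  map_smul' c φ := by
    simp only [PiLp.smul_apply, smul_eq_mul, mul_div_assoc, mul_smul, smul_add, RingHom.id_apply]

/-- The four-qubit code `Q₄`, the image of the encoder `En4`. -/
noncomputable def Q4 : Submodule ℂ (Qubits 4) := LinearMap.range En4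

-- Lower bound: deleting a known qubit is an erasure, so decodability yields Knill-Laflamme
-- conditions: for two encoded basis states `v`, `w`, the slices at each position have equal Gram
-- matrices and are mutually orthogonal (`erasureCondition_of_decode`). For length at most three
-- these conditions force `v = 0`. Length three is the delicate case: with `M = |v⟩⟨v| + |w⟩⟨w|`, `N
-- = ‖v‖²` and `G i` the Gram matrix of the slices at position `i`, `shadow_identity` becomes `|ω|²
-- = N² - ∑ i, ‖G i‖²` in Hilbert-Schmidt norm. Each `G i` is 2 by 2 of trace `N`, so the right side
-- is at most `-N²/2`.
--
-- The code `Q4`: amplitudes depend only on Hamming weight, so the effect of a deletion does not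
-- depend on its position. The two values of the lost qubit give, with equal weight, isometric
-- copies of the input with orthogonal ranges (`q4Kraus_mul_conjTranspose`), and `exists_decoder`
-- maps both copies back to the input.

open Matrix

-- Quantum operations as positive, trace-preserving linear maps

section PositiveMaps

open scoped CStarAlgebra MatrixOrder Matrix.Norms.L2Operator ComplexOrder

/-- A quantum operation as a linear map. -/
noncomputable def QuantumOperation.toLinear {m n : ℕ} (Φ : QuantumOperation m n) :
    QubitMatrix m →ₗ[ℂ] QubitMatrix n :=
  Φ.toCP.toLinearMap

theorem QuantumOperation.toLinear_apply {m n : ℕ} (Φ : QuantumOperation m n)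
    (A : QubitMatrix m) : Φ.toLinear A = Φ.apply A := rfl

theorem QuantumOperation.trace_toLinear {m n : ℕ} (Φ : QuantumOperation m n)
    (A : QubitMatrix m) : (Φ.toLinear A).trace = A.trace := Φ.trace_map A

/-- Of complete positivity, the lower bound needs only this. -/
theorem QuantumOperation.posSemidef_toLinear {m n : ℕ} (Φ : QuantumOperation m n)
    {A : QubitMatrix m} (hA : A.PosSemidef) : (Φ.toLinear A).PosSemidef := by
  rw [← Matrix.nonneg_iff_posSemidef] at hA ⊢
  exact map_nonneg Φ.toCP hA

end PositiveMaps

-- Extremality of rank-one positive matrices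

section RankOne

open scoped ComplexOrder

variable {ι : Type*} [Fintype ι]

theorem star_vecMul_vecMulVec_mulVec (a u : ι → ℂ) :
    star u ⬝ᵥ (vecMulVec a (star a) *ᵥ u) = (star u ⬝ᵥ a) * (star a ⬝ᵥ u) := by
  rw [Matrix.vecMulVec_mulVec, dotProduct_smul]
  simp [mul_comm]

/-- A positive semidefinite matrix dominated by a multiple of a rank-one projection is itself
a multiple of that projection. -/
theorem Matrix.PosSemidef.smul_eq_trace_smul_vecMulVec {M : Matrix ι ι ℂ} (hM : M.PosSemidef)
    (φ : ι → ℂ) (c : ℂ) (h : (c • vecMulVec φ (star φ) - M).PosSemidef) :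
    (star φ ⬝ᵥ φ) • M = M.trace • vecMulVec φ (star φ) := by
  -- On `φ^⊥` the dominating form vanishes, so the form of `M` is squeezed to zero there.
  have horth : ∀ u : ι → ℂ, star φ ⬝ᵥ u = 0 → M *ᵥ u = 0 := by
    intro u hu
    rw [← hM.dotProduct_mulVec_zero_iff]
    refine le_antisymm ?_ (hM.dotProduct_mulVec_nonneg u)
    have h1 := h.dotProduct_mulVec_nonneg u
    rw [Matrix.sub_mulVec, Matrix.smul_mulVec, dotProduct_sub, dotProduct_smul,
      star_vecMul_vecMulVec_mulVec, hu] at h1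
    simpa using h1
  set s := star φ ⬝ᵥ φ with hs
  have hmul : ∀ u : ι → ℂ, s • (M *ᵥ u) = (star φ ⬝ᵥ u) • (M *ᵥ φ) := by
    intro u
    have := horth (s • u - (star φ ⬝ᵥ u) • φ) (by
      simp [dotProduct_sub, dotProduct_smul, ← hs, mul_comm])
    rwa [Matrix.mulVec_sub, Matrix.mulVec_smul, Matrix.mulVec_smul, sub_eq_zero] at this
  by_cases hs0 : s = 0
  · have hφ : φ = 0 := dotProduct_star_self_eq_zero.1 hs0
    subst hφ
    simp [hs0]
  classical
  have hM1 : s • M = vecMulVec (M *ᵥ φ) (star φ) := by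
    refine Matrix.ext_of_mulVec_single fun j => ?_
    rw [Matrix.smul_mulVec, hmul, Matrix.vecMulVec_mulVec]
    simp
  have hss : star s = s := by
    exact (Matrix.star_dotProduct φ φ).symm
  have hM2 : s • M = vecMulVec φ (star (M *ᵥ φ)) := by
    have := congrArg Matrix.conjTranspose hM1
    rwa [Matrix.conjTranspose_smul, hM.isHermitian.eq, hss, Matrix.conjTranspose_vecMulVec,
      star_star] at this
  -- By `hM2` the range of `s • M` lies in the line of `φ`.
  obtain ⟨κ, hκ⟩ : ∃ κ : ℂ, s • (M *ᵥ φ) = κ • φ := by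
    refine ⟨star (M *ᵥ φ) ⬝ᵥ φ, ?_⟩
    rw [← Matrix.smul_mulVec, hM2, Matrix.vecMulVec_mulVec]
    simp
  have hM3 : s • s • M = κ • vecMulVec φ (star φ) := by
    rw [hM1, ← Matrix.smul_vecMulVec, hκ, Matrix.smul_vecMulVec]
  have htr := congrArg Matrix.trace hM3
  rw [Matrix.trace_smul, Matrix.trace_smul, Matrix.trace_smul, Matrix.trace_vecMulVec,
    dotProduct_comm φ, ← hs, smul_eq_mul, smul_eq_mul, smul_eq_mul] at htr
  have hκ' : κ = s * M.trace := by
    apply mul_right_cancel₀ hs0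
    rw [← htr]; ring
  rw [hκ', mul_smul] at hM3
  exact smul_right_injective _ hs0 hM3

end RankOne

-- Partial trace as a sum over the values of the deleted qubit

section Slices

/-- The amplitudes of `ψ` on the basis states whose `i`-th qubit is `c`. -/
noncomputable def slice {m : ℕ} (i : Fin (m + 1)) (c : Fin 2) :
    Qubits (m + 1) →ₗ[ℂ] ((Fin m → Fin 2) → ℂ) where
  toFun ψ x := ψ (i.insertNth c x)
  map_add' _ _ := rfl
  map_smul' _ _ := rfl

theorem slice_apply {m : ℕ} (i : Fin (m + 1)) (c : Fin 2) (ψ : Qubits (m + 1))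
    (x : Fin m → Fin 2) : slice i c ψ x = ψ (i.insertNth c x) := rfl

theorem deleteAt_eq_removeNth {m : ℕ} (i : Fin (m + 1)) (x : Fin (m + 1) → Fin 2) :
    deleteAt i x = i.removeNth x := by
  funext j
  change Fin m at j
  simp only [deleteAt, Fin.removeNth, Fin.succAbove, Fin.lt_def, Fin.val_castSucc]
  split_ifs <;> rfl

theorem deletion_apply {m : ℕ} (i : Fin (m + 1)) (A : QubitMatrix (m + 1))
    (x y : Fin m → Fin 2) :
    deletion i A x y = ∑ c, A (i.insertNth c x) (i.insertNth c y) := by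
  have h1 : deletion i A x y = ∑ p : Fin (m + 1) → Fin 2, ∑ q : Fin (m + 1) → Fin 2,
      (A p q * (if p i = q i then 1 else 0)) *
        (if i.removeNth p = x ∧ i.removeNth q = y then 1 else 0) := by
    unfold deletion
    rw [Matrix.sum_apply]
    refine Finset.sum_congr rfl fun p _ => ?_
    rw [Matrix.sum_apply]
    refine Finset.sum_congr rfl fun q _ => ?_
    rw [Matrix.smul_apply, smul_eq_mul]
    congr 1
    · congr 1
      by_cases h : p i = q i
      · simp [h, Matrix.trace_single_eq_same]
      · simp [h, Matrix.trace_single_eq_of_ne]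
    · rw [deleteAt_eq_removeNth, deleteAt_eq_removeNth, Matrix.single_apply]
  have hrem : ∀ (c : Fin 2) (z : Fin m → Fin 2),
      i.removeNth (i.insertNth c z : Fin (m + 1) → Fin 2) = z := fun c z =>
    Fin.removeNth_insertNth (α := fun _ => Fin 2) i c z
  have hsum : ∀ f : (Fin (m + 1) → Fin 2) → ℂ, ∑ p, f p = ∑ c, ∑ z, f (i.insertNth c z) := by
    intro f
    rw [← (Fin.insertNthEquiv (fun _ => Fin 2) i).sum_comp, Fintype.sum_prod_type]
    rfl
  simp only [h1, hsum, hrem, Fin.insertNth_apply_same, mul_ite, mul_one, mul_zero, ite_and]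
  refine Finset.sum_congr rfl fun c _ => ?_
  simp

theorem deletion_pureState {m : ℕ} (i : Fin (m + 1)) (ψ : Qubits (m + 1)) :
    deletion i (pureState ψ) = ∑ c, vecMulVec (slice i c ψ) (star (slice i c ψ)) := by
  ext x y
  rw [Matrix.sum_apply]
  exact deletion_apply i _ x y

theorem deletion_smul {n : ℕ} (i : Fin n) (c : ℂ) (A : QubitMatrix n) :
    deletion i (c • A) = c • deletion i A := by
  simp only [deletion, Finset.smul_sum, smul_smul, Matrix.smul_apply, smul_eq_mul, mul_assoc]

theorem pureState_smul {n : ℕ} (c : ℂ) (ψ : Qubits n) :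
    pureState (c • ψ) = (c * star c) • pureState ψ := by
  ext x y
  simp only [pureState, Matrix.of_apply, PiLp.smul_apply, Matrix.smul_apply, smul_eq_mul, star_mul]
  ring

theorem pureState_eq_vecMulVec {n : ℕ} (ψ : Qubits n) :
    pureState ψ = vecMulVec ⇑ψ (star ⇑ψ) := rfl

end Slices

-- From decodability to the Knill-Laflamme conditions

section KnillLaflamme

open scoped ComplexOrder

/-- The rows `(a, b)` and `(-b̄, ā)` form a multiple of a unitary matrix. This is the unitary
freedom in splitting a mixed state into branches. -/
theorem star_smul_slices_mul (a b x y x' y' : ℂ) :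
    (a * x + b * y) * star (a * x' + b * y') +
      (-star b * x + star a * y) * star (-star b * x' + star a * y') =
    (a * star a + b * star b) * (x * star x' + y * star y') := by
  simp only [star_add, star_mul', star_neg, star_star]
  ring

/-- A decoder that recovers every state from the deletion of qubit `i` also recovers it, up to
normalization, from any single branch of the deletion. -/
theorem decode_branch {m k : ℕ} (Φ : QuantumOperation m k) (i : Fin (m + 1))
    (ψ : Qubits (m + 1)) (φ : Qubits k)
    (h : Φ.toLinear (deletion i (pureState ψ)) = pureState φ) (a b : ℂ) :
    (star ⇑φ ⬝ᵥ ⇑φ) • Φ.toLinear (vecMulVec (a • slice i 0 ψ + b • slice i 1 ψ)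
        (star (a • slice i 0 ψ + b • slice i 1 ψ))) =
      ((a • slice i 0 ψ + b • slice i 1 ψ) ⬝ᵥ star (a • slice i 0 ψ + b • slice i 1 ψ)) •
        vecMulVec ⇑φ (star ⇑φ) := by
  set u := a • slice i 0 ψ + b • slice i 1 ψ with hu
  set u' := -star b • slice i 0 ψ + star a • slice i 1 ψ with hu'
  have hsplit : vecMulVec u (star u) + vecMulVec u' (star u') =
      (a * star a + b * star b) • deletion i (pureState ψ) := by
    ext x y
    rw [deletion_pureState, Fin.sum_univ_two]
    exact star_smul_slices_mul a b _ _ _ _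
  have hpos := Φ.posSemidef_toLinear (posSemidef_vecMulVec_self_star u)
  have hpos' := Φ.posSemidef_toLinear (posSemidef_vecMulVec_self_star u')
  have hdom : ((a * star a + b * star b) • vecMulVec ⇑φ (star ⇑φ) -
      Φ.toLinear (vecMulVec u (star u))).PosSemidef := by
    rw [← pureState_eq_vecMulVec, ← h, ← map_smul, ← hsplit, map_add, add_sub_cancel_left]
    exact hpos'
  rw [hpos.smul_eq_trace_smul_vecMulVec _ _ hdom, Φ.trace_toLinear, Matrix.trace_vecMulVec]

theorem star_ket_dotProduct {k : ℕ} {x y : Fin k → Fin 2} (hxy : x ≠ y) {t : ℂ}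
    (ht : t * star t = 1) :
    star (⇑(ket x + t • ket y)) ⬝ᵥ ⇑(ket x + t • ket y) = 2 := by
  have : ∀ z, star (⇑(ket x + t • ket y)) z * (ket x + t • ket y) z =
      (if z = x then 1 else 0) + (if z = y then 1 else 0) := by
    intro z
    simp only [ket, Pi.star_apply, PiLp.add_apply, PiLp.smul_apply, PiLp.single_apply, smul_eq_mul]
    by_cases h1 : z = x
    · subst h1
      simp [hxy]
    · by_cases h2 : z = y
      · subst h2
        simp only [h1, if_true, if_false, zero_add, mul_one]
        rw [mul_comm]; exact ht
      · simp [h1, h2]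
  simp only [dotProduct, this, Finset.sum_add_distrib]
  norm_num

/-- If a linear map `D` recovers every `φ`, up to normalization, from `L φ`, then `L` preserves
orthogonality and equality of norms of two basis states. -/
theorem gram_eq_of_decode {m k : ℕ} (D : QubitMatrix m →ₗ[ℂ] QubitMatrix k)
    (L : Qubits k →ₗ[ℂ] ((Fin m → Fin 2) → ℂ))
    (hD : ∀ φ : Qubits k, (star ⇑φ ⬝ᵥ ⇑φ) • D (vecMulVec (L φ) (star (L φ))) =
      (L φ ⬝ᵥ star (L φ)) • vecMulVec ⇑φ (star ⇑φ))
    {x y : Fin k → Fin 2} (hxy : x ≠ y) :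
    L (ket x) ⬝ᵥ star (L (ket x)) = L (ket y) ⬝ᵥ star (L (ket y)) ∧
      L (ket x) ⬝ᵥ star (L (ket y)) = 0 := by
  have hket : ∀ z : Fin k → Fin 2, D (vecMulVec (L (ket z)) (star (L (ket z)))) =
      (L (ket z) ⬝ᵥ star (L (ket z))) • vecMulVec ⇑(ket z) (star ⇑(ket z)) := by
    intro z
    have := hD (ket z)
    have h1 : star ⇑(ket z) ⬝ᵥ ⇑(ket z) = 1 := by
      simp [dotProduct, ket]
    rwa [h1, one_smul] at this
  -- Compare `|x⟩ + t|y⟩` with `|x⟩ - t|y⟩`: by the parallelogram law the sum of their decoded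
  -- states has no off-diagonal part, so the weights `qp` and `qm` agree. The diagonal entries then
  -- give equal norms.
  have key : ∀ t : ℂ, t * star t = 1 →
      L (ket x) ⬝ᵥ star (L (ket x)) = L (ket y) ⬝ᵥ star (L (ket y)) ∧
      star t * (L (ket x) ⬝ᵥ star (L (ket y))) + t * (L (ket y) ⬝ᵥ star (L (ket x))) = 0 := by
    intro t ht
    have ht' : -t * star (-t) = 1 := by simpa using ht
    have hp := hD (ket x + t • ket y)
    have hm := hD (ket x + (-t) • ket y)
    rw [star_ket_dotProduct hxy ht] at hp
    rw [star_ket_dotProduct hxy ht'] at hm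
    set qp := L (ket x + t • ket y) ⬝ᵥ star (L (ket x + t • ket y)) with hqp
    set qm := L (ket x + (-t) • ket y) ⬝ᵥ star (L (ket x + (-t) • ket y)) with hqm
    have hpar : vecMulVec (L (ket x + t • ket y)) (star (L (ket x + t • ket y))) +
        vecMulVec (L (ket x + (-t) • ket y)) (star (L (ket x + (-t) • ket y))) =
        (2 : ℂ) • vecMulVec (L (ket x)) (star (L (ket x))) +
          (2 : ℂ) • vecMulVec (L (ket y)) (star (L (ket y))) := by
      ext p q
      simp only [map_add, map_smul, Matrix.add_apply, Matrix.smul_apply, vecMulVec_apply,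
        Pi.add_apply, Pi.smul_apply, Pi.star_apply, smul_eq_mul, star_add, star_mul', star_neg]
      linear_combination (2 * L (ket y) p * star (L (ket y) q)) * ht
    have hsum := congrArg (fun M => (2 : ℂ) • D M) hpar
    simp only [map_add D, map_smul D, smul_add] at hsum
    rw [hp, hm, hket, hket] at hsum
    have hyx := hxy.symm
    have hxx := congrFun (congrFun hsum x) x
    have hyy := congrFun (congrFun hsum y) y
    have hxy' := congrFun (congrFun hsum x) y
    simp [ket, vecMulVec_apply, hxy, hyx] at hxx hyy hxy'
    have ht2 : t * (starRingEnd ℂ) t = 1 := ht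
    have htne : (starRingEnd ℂ) t ≠ 0 := right_ne_zero_of_mul_eq_one ht2
    have hq : qp = qm := by
      apply mul_right_cancel₀ htne
      linear_combination hxy'
    refine ⟨?_, ?_⟩
    · simp only [ket]
      linear_combination (-1 / 4 : ℂ) * hxx + (1 / 4 : ℂ) * hyy - (qp + qm) / 4 * ht2
    · have : qp - qm = 2 * (star t * (L (ket x) ⬝ᵥ star (L (ket y))) +
          t * (L (ket y) ⬝ᵥ star (L (ket x)))) := by
        rw [hqp, hqm]
        simp only [map_add, map_smul, star_add, star_smul, star_neg, dotProduct_add,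
          add_dotProduct, smul_dotProduct, dotProduct_smul, smul_eq_mul]
        ring
      rw [hq, sub_self] at this
      simpa using this.symm
  refine ⟨(key 1 (by simp)).1, ?_⟩
  have h1 := (key 1 (by simp)).2
  have hI := (key Complex.I (by simp)).2
  simp only [star_one, one_mul, Complex.star_def, Complex.conj_I] at h1 hI
  have h2 : Complex.I * (2 * (L (ket x) ⬝ᵥ star (L (ket y)))) = 0 := by
    linear_combination Complex.I * h1 - hI
  simpa using h2

/-- The Knill-Laflamme conditions for the erasure of qubit `i`, for a pair of code vectors. -/
def ErasureCondition {m : ℕ} (v w : Qubits (m + 1)) : Prop :=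
  ∀ (i : Fin (m + 1)) (c d : Fin 2),
    slice i c v ⬝ᵥ star (slice i d v) = slice i c w ⬝ᵥ star (slice i d w) ∧
    slice i c v ⬝ᵥ star (slice i d w) = 0

/-- Polarization: `(1, 0)` and `(0, 1)` kill the diagonal, `(1, 1)` and `(1, i)` the rest. -/
theorem polarization_zero {f : Fin 2 → Fin 2 → ℂ}
    (h : ∀ a b : ℂ, a * star a * f 0 0 + a * star b * f 0 1 + b * star a * f 1 0 +
      b * star b * f 1 1 = 0) (c d : Fin 2) : f c d = 0 := by
  have h0 := h 1 0
  have h1 := h 0 1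
  have h2 := h 1 1
  have h3 := h 1 Complex.I
  simp only [star_one, star_zero, mul_one, mul_zero, one_mul, zero_mul, add_zero, zero_add,
    Complex.star_def, Complex.conj_I] at h0 h1 h2 h3
  have h4 : f 0 1 + f 1 0 = 0 := by linear_combination h2 - h0 - h1
  have h5 : Complex.I * (2 * f 0 1) = 0 := by
    linear_combination h0 - h3 - Complex.I * Complex.I * h1 + Complex.I * h4
  have h6 : f 0 1 = 0 := by simpa using h5
  fin_cases c <;> fin_cases d
  · exact h0
  · exact h6
  · simpa [h6] using h4
  · exact h1

theorem erasureCondition_of_decode {m k : ℕ} (Φ : QuantumOperation m k)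
    (E : Qubits k →ₗ[ℂ] Qubits (m + 1))
    (hE : ∀ φ i, Φ.toLinear (deletion i (pureState (E φ))) = pureState φ)
    {x y : Fin k → Fin 2} (hxy : x ≠ y) : ErasureCondition (E (ket x)) (E (ket y)) := by
  intro i c d
  -- Every combination of the two slices is itself a branch of the deletion; varying `a`, `b`
  -- separates the conditions for individual `c`, `d`.
  have key := fun a b : ℂ => gram_eq_of_decode Φ.toLinear
    ((a • slice i 0 + b • slice i 1) ∘ₗ E) (fun φ => decode_branch Φ i (E φ) φ (hE φ i) a b) hxy
  simp only [LinearMap.comp_apply, LinearMap.add_apply, LinearMap.smul_apply, star_add, star_smul,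
    dotProduct_add, add_dotProduct, smul_dotProduct, dotProduct_smul, smul_eq_mul] at key
  refine ⟨sub_eq_zero.1 ?_, ?_⟩
  · refine polarization_zero (f := fun c d => slice i c (E (ket x)) ⬝ᵥ star (slice i d (E (ket x)))
      - slice i c (E (ket y)) ⬝ᵥ star (slice i d (E (ket y)))) (fun a b => ?_) c d
    linear_combination (key a b).1
  · refine polarization_zero (f := fun c d => slice i c (E (ket x)) ⬝ᵥ star (slice i d (E (ket y))))
      (fun a b => ?_) c d
    linear_combination (key a b).2

theorem IsSingleDeletionCode.exists_erasureCondition {m k : ℕ} (hk : 1 ≤ k)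
    {Q : Submodule ℂ (Qubits (m + 1))} (h : IsSingleDeletionCode (m + 1) k Q) :
    ∃ v w : Qubits (m + 1), v ≠ 0 ∧ ErasureCondition v w := by
  obtain ⟨Enc, Dec, hdec⟩ := h
  have hne : (fun _ => 0 : Fin k → Fin 2) ≠ fun _ => 1 := fun h => by
    simpa using congrFun h ⟨0, hk⟩
  refine ⟨Enc (ket fun _ => 0), Enc (ket fun _ => 1), ?_, ?_⟩
  · intro h0
    have h1 : ket (fun _ : Fin k => (0 : Fin 2)) = 0 := by simpa using h0
    have := congrFun (congrArg (fun v : Qubits k => ⇑v) h1) fun _ => 0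
    simp [ket] at this
  · refine erasureCondition_of_decode Dec (Q.subtype ∘ₗ Enc.toLinearMap) (fun φ i => ?_) hne
    change Dec.toLinear (deletion i (pureState (Enc φ : Qubits (m + 1)))) = pureState φ
    -- Decoding is assumed for unit vectors only; both sides scale by `|c|²`, which extends it to
    -- all `φ`.
    by_cases hφ : φ = 0
    · subst hφ
      have hz : ∀ n, pureState (0 : Qubits n) = 0 := fun n => by
        ext; simp [pureState]
      have hd : deletion i (0 : QubitMatrix (m + 1)) = 0 := by
        simpa using deletion_smul i 0 (0 : QubitMatrix (m + 1))
      simp [hz, hd]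
    · have hn : (‖φ‖ : ℂ) ≠ 0 := by simpa using hφ
      have hu : ‖(‖φ‖ : ℂ)⁻¹ • φ‖ = 1 := by
        rw [norm_smul, norm_inv, Complex.norm_real, norm_norm]
        exact inv_mul_cancel₀ (norm_ne_zero_iff.2 hφ)
      have h1 := hdec _ hu i
      rw [← QuantumOperation.toLinear_apply, map_smul, Submodule.coe_smul, pureState_smul,
        pureState_smul, deletion_smul, map_smul] at h1
      refine smul_right_injective _ ?_ h1
      simp [hφ]

end KnillLaflamme

-- No codes of length at most three

section LowerBound

open scoped ComplexOrder

theorem star_dotProduct_flip {ι : Type*} [Fintype ι] (v w : ι → ℂ) :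
    w ⬝ᵥ star v = star (v ⬝ᵥ star w) := by
  simp [dotProduct, mul_comm]

/-- Slices are scalars here: orthogonality makes one of `v_c`, `w_c` vanish, and equal moduli make
both vanish. -/
theorem ErasureCondition.eq_zero_of_length_one {v w : Qubits 1} (h : ErasureCondition v w) :
    v = 0 := by
  have hdot : ∀ f g : (Fin 0 → Fin 2) → ℂ, f ⬝ᵥ star g = f default * star (g default) := by
    intro f g
    rw [dotProduct, Fintype.sum_subsingleton _ default]
    rfl
  have hv : ∀ c, slice 0 c v default = 0 := by
    intro c
    by_contra hc
    have hw := (h 0 c c).2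
    have hvv := (h 0 c c).1
    rw [hdot] at hw hvv
    rw [hdot] at hvv
    have hw0 : slice 0 c w default = 0 := star_eq_zero.1 ((mul_eq_zero.1 hw).resolve_left hc)
    rw [hw0, zero_mul] at hvv
    exact hc ((mul_eq_zero.1 hvv).elim id star_eq_zero.1)
  ext x
  have := hv (x 0)
  rw [slice_apply] at this
  rw [PiLp.zero_apply, ← this]
  refine congrArg (fun z => v z) (funext fun j => ?_)
  fin_cases j
  rfl

/-- As 2 by 2 matrices, `V * Wᴴ = 0` (erasing the first qubit) and `Vᴴ * V = Wᴴ * W` (the second).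
Hence `V * Vᴴ * V = V * Wᴴ * W = 0`, which forces `V = 0`. -/
theorem ErasureCondition.eq_zero_of_length_two {v w : Qubits 2} (h : ErasureCondition v w) :
    v = 0 := by
  let V : Matrix (Fin 2) (Fin 2) ℂ := Matrix.of fun a b => v ![a, b]
  let W : Matrix (Fin 2) (Fin 2) ℂ := Matrix.of fun a b => w ![a, b]
  have hsum : ∀ f : (Fin 1 → Fin 2) → ℂ, ∑ z, f z = ∑ b, f ![b] := by
    intro f
    rw [← (Equiv.funUnique (Fin 1) (Fin 2)).symm.sum_comp]
    refine Finset.sum_congr rfl fun b _ => congrArg f (funext fun j => ?_)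
    fin_cases j
    rfl
  have h0 : ∀ a b : Fin 2, (Fin.insertNth 0 a ![b] : Fin 2 → Fin 2) = ![a, b] := by decide
  have h1 : ∀ a b : Fin 2, (Fin.insertNth 1 a ![b] : Fin 2 → Fin 2) = ![b, a] := by decide
  have hrow : V * Wᴴ = 0 := by
    ext c d
    have := (h 0 c d).2
    simp only [dotProduct, hsum, Pi.star_apply, slice_apply, h0] at this
    exact this
  have hcol : Vᴴ * V = Wᴴ * W := by
    ext d c
    have := (h 1 c d).1
    simp only [dotProduct, hsum, Pi.star_apply, slice_apply, h1] at this
    simp only [Matrix.mul_apply, Matrix.conjTranspose_apply, V, W, Matrix.of_apply]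
    simpa only [mul_comm] using this
  have hV : V = 0 := by
    have h3 : V * (Vᴴ * V) = 0 := by
      rw [hcol, ← Matrix.mul_assoc, hrow, Matrix.zero_mul]
    have h4 : (Vᴴ * V)ᴴ * (Vᴴ * V) = 0 := by
      rw [Matrix.conjTranspose_mul, Matrix.conjTranspose_conjTranspose, Matrix.mul_assoc, h3,
        Matrix.mul_zero]
    exact Matrix.conjTranspose_mul_self_eq_zero.1 (Matrix.conjTranspose_mul_self_eq_zero.1 h4)
  ext x
  have := congrFun (congrFun hV (x 0)) (x 1)
  rw [PiLp.zero_apply, ← show V (x 0) (x 1) = (0 : ℂ) from this]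
  change v x = v ![x 0, x 1]
  refine congrArg (fun z => v z) (funext fun j => ?_)
  fin_cases j <;> rfl

/-- The shadow identity for an operator `|v⟩⟨a| + |w⟩⟨b|` on three qubits. -/
theorem shadow_identity (v w a b : Fin 2 → Fin 2 → Fin 2 → ℂ) :
    2 * (v 0 0 0 * w 1 1 1 - v 0 0 1 * w 1 1 0 - v 0 1 0 * w 1 0 1 - v 1 0 0 * w 0 1 1 +
        v 0 1 1 * w 1 0 0 + v 1 0 1 * w 0 1 0 + v 1 1 0 * w 0 0 1 - v 1 1 1 * w 0 0 0) *
      (a 0 0 0 * b 1 1 1 - a 0 0 1 * b 1 1 0 - a 0 1 0 * b 1 0 1 - a 1 0 0 * b 0 1 1 +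
        a 0 1 1 * b 1 0 0 + a 1 0 1 * b 0 1 0 + a 1 1 0 * b 0 0 1 - a 1 1 1 * b 0 0 0) +
    ((∑ c, ∑ x, ∑ y, v c x y * a c x y) ^ 2 + (∑ c, ∑ x, ∑ y, w c x y * b c x y) ^ 2 +
      2 * (∑ c, ∑ x, ∑ y, v c x y * b c x y) * (∑ c, ∑ x, ∑ y, w c x y * a c x y)) +
    (∑ c, ∑ d, ((∑ x, ∑ y, v c x y * a d x y) + ∑ x, ∑ y, w c x y * b d x y) *
      ((∑ x, ∑ y, v d x y * a c x y) + ∑ x, ∑ y, w d x y * b c x y)) +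
    (∑ c, ∑ d, ((∑ x, ∑ y, v x c y * a x d y) + ∑ x, ∑ y, w x c y * b x d y) *
      ((∑ x, ∑ y, v x d y * a x c y) + ∑ x, ∑ y, w x d y * b x c y)) +
    (∑ c, ∑ d, ((∑ x, ∑ y, v x y c * a x y d) + ∑ x, ∑ y, w x y c * b x y d) *
      ((∑ x, ∑ y, v x y d * a x y c) + ∑ x, ∑ y, w x y d * b x y c)) =
    (∑ c, ∑ d, ((∑ x, ∑ y, v c x y * a d x y) * (∑ x, ∑ y, v d x y * a c x y) +
      (∑ x, ∑ y, w c x y * b d x y) * (∑ x, ∑ y, w d x y * b c x y) +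
      2 * (∑ x, ∑ y, v c x y * b d x y) * (∑ x, ∑ y, w d x y * a c x y))) +
    (∑ c, ∑ d, ((∑ x, ∑ y, v x c y * a x d y) * (∑ x, ∑ y, v x d y * a x c y) +
      (∑ x, ∑ y, w x c y * b x d y) * (∑ x, ∑ y, w x d y * b x c y) +
      2 * (∑ x, ∑ y, v x c y * b x d y) * (∑ x, ∑ y, w x d y * a x c y))) +
    (∑ c, ∑ d, ((∑ x, ∑ y, v x y c * a x y d) * (∑ x, ∑ y, v x y d * a x y c) +
      (∑ x, ∑ y, w x y c * b x y d) * (∑ x, ∑ y, w x y d * b x y c) +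
      2 * (∑ x, ∑ y, v x y c * b x y d) * (∑ x, ∑ y, w x y d * a x y c))) +
    ((∑ c, ∑ x, ∑ y, v c x y * a c x y) + ∑ c, ∑ x, ∑ y, w c x y * b c x y) ^ 2 := by
  -- The identity comes from applying `σ_y ρᵀ σ_y = tr(ρ) 1 - ρ` on each qubit. Since `σ_y^{⊗3}` is
  -- antisymmetric, only the pairing of `v` with `w` survives.
  simp only [Fin.sum_univ_two]
  ring

/-- A `2 × 2` matrix of trace `N` has squared Hilbert-Schmidt norm at least `N² / 2`. -/
theorem half_sq_trace_le (f : Fin 2 → Fin 2 → ℂ) (N : ℝ) (hN : f 0 0 + f 1 1 = N) :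
    N ^ 2 / 2 ≤ ∑ c, ∑ d, Complex.normSq (f c d) := by
  simp only [Fin.sum_univ_two, Complex.normSq_apply]
  have h1 : (f 0 0).re + (f 1 1).re = N := by simpa using congrArg Complex.re hN
  rw [← h1]
  nlinarith [sq_nonneg ((f 0 0).re - (f 1 1).re), sq_nonneg (f 0 0).im, sq_nonneg (f 1 1).im,
    sq_nonneg (f 0 1).re, sq_nonneg (f 0 1).im, sq_nonneg (f 1 0).re, sq_nonneg (f 1 0).im]

theorem ErasureCondition.eq_zero_of_length_three {v w : Qubits 3} (h : ErasureCondition v w) :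
    v = 0 := by
  have hsum : ∀ f : (Fin 2 → Fin 2) → ℂ, ∑ z, f z = ∑ a, ∑ b, f ![a, b] := by
    intro f
    rw [← (finTwoArrowEquiv (Fin 2)).symm.sum_comp, Fintype.sum_prod_type]
    rfl
  have h0 : ∀ a b c : Fin 2, (Fin.insertNth 0 a ![b, c] : Fin 3 → Fin 2) = ![a, b, c] := by decide
  have h1 : ∀ a b c : Fin 2, (Fin.insertNth 1 a ![b, c] : Fin 3 → Fin 2) = ![b, a, c] := by decide
  have h2 : ∀ a b c : Fin 2, (Fin.insertNth 2 a ![b, c] : Fin 3 → Fin 2) = ![b, c, a] := by decide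
  obtain ⟨V, hV⟩ : ∃ V : Fin 2 → Fin 2 → Fin 2 → ℂ, V = fun a b c => v ![a, b, c] := ⟨_, rfl⟩
  obtain ⟨W, hW⟩ : ∃ W : Fin 2 → Fin 2 → Fin 2 → ℂ, W = fun a b c => w ![a, b, c] := ⟨_, rfl⟩
  have hVa : ∀ a b c, v ![a, b, c] = V a b c := fun a b c => by rw [hV]
  have hWa : ∀ a b c, w ![a, b, c] = W a b c := fun a b c => by rw [hW]
  -- the Gram matrices of the slices at the three positions
  obtain ⟨G, hG⟩ : ∃ G : Fin 3 → Fin 2 → Fin 2 → ℂ,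
      G = fun i c d => slice i c v ⬝ᵥ star (slice i d v) := ⟨_, rfl⟩
  have hGv : ∀ i c d, slice i c v ⬝ᵥ star (slice i d v) = G i c d := fun i c d => by rw [hG]
  have hGw : ∀ i c d, slice i c w ⬝ᵥ star (slice i d w) = G i c d := fun i c d => by
    rw [← hGv, (h i c d).1]
  have hGstar : ∀ i c d, G i d c = star (G i c d) := fun i c d => by
    rw [← hGv, ← hGv, star_dotProduct_flip]
  have hvw : ∀ i c d, slice i c v ⬝ᵥ star (slice i d w) = 0 := fun i c d => (h i c d).2
  have hGv0 := hGv 0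
  have hGv1 := hGv 1
  have hGv2 := hGv 2
  have hGw0 := hGw 0
  have hGw1 := hGw 1
  have hGw2 := hGw 2
  have hvw0 := hvw 0
  have hvw1 := hvw 1
  have hvw2 := hvw 2
  simp only [dotProduct, hsum, Pi.star_apply, slice_apply, h0, h1, h2, hVa, hWa]
    at hGv0 hGv1 hGv2 hGw0 hGw1 hGw2 hvw0 hvw1 hvw2
  have hid := shadow_identity V W (fun a b c => star (V a b c)) (fun a b c => star (W a b c))
  simp only [hGv0, hGv1, hGv2, hGw0, hGw1, hGw2, hvw0, hvw1, hvw2] at hid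
  -- the squared norm of `v`
  obtain ⟨N, hN⟩ : ∃ N : ℝ, N = ∑ a, ∑ b, ∑ c, Complex.normSq (V a b c) := ⟨_, rfl⟩
  have hNC : ∑ a, ∑ b, ∑ c, V a b c * star (V a b c) = N := by
    rw [hN]
    push_cast
    simp only [Complex.star_def, Complex.mul_conj]
  have htr0 : G 0 0 0 + G 0 1 1 = N := by
    rw [← hGv0, ← hGv0, ← hNC]
    simp only [Fin.sum_univ_two]
  have htr1 : G 1 0 0 + G 1 1 1 = N := by
    rw [← hGv1, ← hGv1, ← hNC]
    simp only [Fin.sum_univ_two]; ring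
  have htr2 : G 2 0 0 + G 2 1 1 = N := by
    rw [← hGv2, ← hGv2, ← hNC]
    simp only [Fin.sum_univ_two]; ring
  have g0 := half_sq_trace_le (G 0) N htr0
  have g1 := half_sq_trace_le (G 1) N htr1
  have g2 := half_sq_trace_le (G 2) N htr2
  have hsq : ∀ i c d, G i c d * G i d c = (Complex.normSq (G i c d) : ℂ) := fun i c d => by
    rw [hGstar i c d, Complex.star_def, Complex.mul_conj]
  have hN0 : N = 0 := by
    set ω : ℂ := V 0 0 0 * W 1 1 1 - V 0 0 1 * W 1 1 0 - V 0 1 0 * W 1 0 1 - V 1 0 0 * W 0 1 1 +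
        V 0 1 1 * W 1 0 0 + V 1 0 1 * W 0 1 0 + V 1 1 0 * W 0 0 1 - V 1 1 1 * W 0 0 0 with hω
    have hωω : ω * star ω = (Complex.normSq ω : ℂ) := by
      rw [Complex.star_def, Complex.mul_conj]
    -- Here `(tr M)² - tr M²` is `4N² - 2N²`. Each position contributes `2‖G i‖²` from the two-qubit
    -- marginal and `-4‖G i‖²` from the one-qubit marginal.
    have hre : 2 * Complex.normSq ω = 2 * N ^ 2 -
        2 * ((∑ c, ∑ d, Complex.normSq (G 0 c d)) + (∑ c, ∑ d, Complex.normSq (G 1 c d)) +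
          ∑ c, ∑ d, Complex.normSq (G 2 c d)) := by
      apply Complex.ofReal_injective
      push_cast
      simp only [← hsq]
      rw [← hωω]
      simp only [hω, star_add, star_sub, star_mul']
      simp only [Fin.sum_univ_two] at hid htr0 ⊢
      rw [htr0] at hid
      linear_combination hid
    -- Three traces bounded below by `N²/2` give `2|ω|² ≤ -N²`.
    nlinarith [Complex.normSq_nonneg ω]
  ext x
  have hx : Complex.normSq (V (x 0) (x 1) (x 2)) = 0 := by
    have hnn : ∀ a b c, 0 ≤ Complex.normSq (V a b c) := fun _ _ _ => Complex.normSq_nonneg _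
    rw [hN] at hN0
    have e1 := (Finset.sum_eq_zero_iff_of_nonneg fun a _ => Finset.sum_nonneg fun b _ =>
      Finset.sum_nonneg fun c _ => hnn a b c).1 hN0 (x 0) (Finset.mem_univ _)
    have e2 := (Finset.sum_eq_zero_iff_of_nonneg fun b _ =>
      Finset.sum_nonneg fun c _ => hnn (x 0) b c).1 e1 (x 1) (Finset.mem_univ _)
    exact (Finset.sum_eq_zero_iff_of_nonneg fun c _ => hnn (x 0) (x 1) c).1 e2 (x 2)
      (Finset.mem_univ _)
  rw [Complex.normSq_eq_zero, ← hVa] at hx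
  rw [PiLp.zero_apply, ← hx]
  refine congrArg (fun z => v z) (funext fun j => ?_)
  fin_cases j <;> rfl

/-- With no position to delete, the decoding condition is vacuous; only the dimension count `2^k ≤
1` excludes this case. -/
theorem not_isSingleDeletionCode_zero {k : ℕ} (hk : 1 ≤ k) (Q : Submodule ℂ (Qubits 0)) :
    ¬ IsSingleDeletionCode 0 k Q := by
  rintro ⟨Enc, -, -⟩
  have h1 := Enc.finrank_eq
  have h2 := Submodule.finrank_le Q
  rw [← h1, finrank_euclideanSpace, finrank_euclideanSpace] at h2
  simp only [Fintype.card_pi, Fintype.card_fin, Finset.prod_const, Finset.card_univ,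
    pow_zero] at h2
  have := Nat.one_lt_two_pow (n := k) (by omega)
  omega

theorem IsSingleDeletionCode.four_le {n k : ℕ} (hk : 1 ≤ k) {Q : Submodule ℂ (Qubits n)}
    (h : IsSingleDeletionCode n k Q) : 4 ≤ n := by
  by_contra! hn
  interval_cases n
  · exact not_isSingleDeletionCode_zero hk Q h
  · obtain ⟨v, w, hv, hvw⟩ := h.exists_erasureCondition hk
    exact hv hvw.eq_zero_of_length_one
  · obtain ⟨v, w, hv, hvw⟩ := h.exists_erasureCondition hk
    exact hv hvw.eq_zero_of_length_two
  · obtain ⟨v, w, hv, hvw⟩ := h.exists_erasureCondition hk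
    exact hv hvw.eq_zero_of_length_three

end LowerBound

-- Kraus maps are quantum operations

section Kraus

open scoped CStarAlgebra MatrixOrder Matrix.Norms.L2Operator

/-- The linear map `A ↦ ∑ r, K r * A * (K r)ᴴ`. -/
noncomputable def krausLinear {m n : ℕ} {ρ : Type} [Fintype ρ]
    (K : ρ → Matrix (Fin n → Fin 2) (Fin m → Fin 2) ℂ) :
    QubitMatrix m →ₗ[ℂ] QubitMatrix n where
  toFun A := ∑ r, K r * A * (K r)ᴴ
  map_add' A B := by simp only [Matrix.mul_add, Matrix.add_mul, Finset.sum_add_distrib]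
  map_smul' c A := by
    simp only [Matrix.mul_smul, Matrix.smul_mul, Finset.smul_sum, RingHom.id_apply]

theorem krausLinear_apply {m n : ℕ} {ρ : Type} [Fintype ρ]
    (K : ρ → Matrix (Fin n → Fin 2) (Fin m → Fin 2) ℂ) (A : QubitMatrix m) :
    krausLinear K A = ∑ r, K r * A * (K r)ᴴ := rfl

theorem sum_conjTranspose_single_mul_single {α β : Type*} [Fintype α] [DecidableEq α] [Fintype β]
    [DecidableEq β] (a : α) :
    ∑ s : β, (Matrix.single a s (1 : ℂ))ᴴ * Matrix.single a s (1 : ℂ) = 1 := by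
  simp only [Matrix.conjTranspose_single, Matrix.single_mul_single_same, star_one, mul_one]
  ext x y
  rw [Matrix.sum_apply]
  simp only [Matrix.single_apply, Matrix.one_apply]
  by_cases h : x = y
  · subst h; simp
  · rw [if_neg h]
    refine Finset.sum_eq_zero fun s _ => if_neg ?_
    rintro ⟨rfl, rfl⟩
    exact h rfl

/-- Positive elements are sums of `star N * N`. Inserting `∑ s, (T s)ᴴ * T s = 1` in the middle
turns the image into a sum of squares, with `T s` making the rectangular `N l j * (K r)ᴴ` square. -/
theorem krausLinear_completelyPositive {m n : ℕ} {ρ : Type} [Fintype ρ]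
    (K : ρ → Matrix (Fin n → Fin 2) (Fin m → Fin 2) ℂ) (k : ℕ)
    (M : CStarMatrix (Fin k) (Fin k) (QubitMatrix m)) (hM : 0 ≤ M) :
    0 ≤ M.map (krausLinear K) := by
  -- the `s`-th row of `N l j * (K r)ᴴ`, stored in the first row of a square matrix
  let T : (Fin m → Fin 2) → Matrix (Fin n → Fin 2) (Fin m → Fin 2) ℂ := fun s =>
    Matrix.single (fun _ => 0) s 1
  let B : CStarMatrix (Fin k) (Fin k) (QubitMatrix m) → ρ → (Fin m → Fin 2) → CStarMatrix (Fin k) (Fin k) (QubitMatrix n) := fun N r s =>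
    CStarMatrix.ofMatrix fun l j => T s * N l j * (K r)ᴴ
  have hT : ∑ s, (T s)ᴴ * T s = 1 := sum_conjTranspose_single_mul_single _
  have hsum : ∀ N : CStarMatrix (Fin k) (Fin k) (QubitMatrix m),
      CStarMatrix.map (star N * N) (krausLinear K) = ∑ r, ∑ s, star (B N r s) * B N r s := by
    intro N
    ext1 i j
    have happ : ∀ {σ : Type} [Fintype σ]
        (F : σ → CStarMatrix (Fin k) (Fin k) (QubitMatrix n)),
        (∑ r, F r) i j = ∑ r, F r i j := fun F => Matrix.sum_apply i j Finset.univ F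
    rw [happ]
    simp_rw [happ]
    rw [CStarMatrix.map_apply, CStarMatrix.mul_apply, map_sum]
    simp_rw [CStarMatrix.mul_apply, CStarMatrix.star_apply, krausLinear_apply]
    rw [Finset.sum_comm]
    refine Finset.sum_congr rfl fun r _ => ?_
    rw [Finset.sum_comm]
    refine Finset.sum_congr rfl fun l _ => ?_
    have hB : ∀ s, star (B N r s l i) * B N r s l j =
        (K r * (N l i)ᴴ) * ((T s)ᴴ * T s) * (N l j * (K r)ᴴ) := by
      intro s
      change (T s * N l i * (K r)ᴴ)ᴴ * (T s * N l j * (K r)ᴴ) = _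
      simp only [Matrix.conjTranspose_mul, Matrix.conjTranspose_conjTranspose, Matrix.mul_assoc]
    trans K r * (N l i)ᴴ * (∑ s, (T s)ᴴ * T s) * (N l j * (K r)ᴴ)
    · rw [hT, Matrix.mul_one]
      simp only [Matrix.mul_assoc, Matrix.star_eq_conjTranspose]
    · rw [Matrix.mul_sum, Matrix.sum_mul]
      exact Finset.sum_congr rfl fun s _ => (hB s).symm
  have hmap_add : ∀ M₁ M₂ : CStarMatrix (Fin k) (Fin k) (QubitMatrix m),
      (M₁ + M₂).map (krausLinear K) = M₁.map (krausLinear K) + M₂.map (krausLinear K) := by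
    intro M₁ M₂
    ext1 i j
    exact map_add (krausLinear K) _ _
  have hmap_zero : (0 : CStarMatrix (Fin k) (Fin k) (QubitMatrix m)).map (krausLinear K) = 0 := by
    ext1 i j
    exact map_zero (krausLinear K)
  rw [StarOrderedRing.nonneg_iff] at hM
  induction hM using AddSubmonoid.closure_induction with
  | zero => exact hmap_zero.ge
  | add M₁ M₂ _ _ h₁ h₂ => rw [hmap_add]; exact add_nonneg h₁ h₂
  | mem M hM =>
  obtain ⟨N, rfl⟩ := hM
  change 0 ≤ CStarMatrix.map (star N * N) (krausLinear K)
  rw [hsum]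
  exact Finset.sum_nonneg fun r _ => Finset.sum_nonneg fun s _ => star_mul_self_nonneg _

/-- The quantum operation with Kraus operators `K`. -/
noncomputable def QuantumOperation.ofKraus {m n : ℕ} {ρ : Type} [Fintype ρ]
    (K : ρ → Matrix (Fin n → Fin 2) (Fin m → Fin 2) ℂ) (hK : ∑ r, (K r)ᴴ * K r = 1) :
    QuantumOperation m n where
  toCP :=
    { krausLinear K with map_cstarMatrix_nonneg' := krausLinear_completelyPositive K }
  trace_map A := by
    change (∑ r, K r * A * (K r)ᴴ).trace = A.trace
    rw [Matrix.trace_sum]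
    simp_rw [Matrix.trace_mul_comm _ (_)ᴴ, ← Matrix.mul_assoc]
    rw [← Matrix.trace_sum, ← Matrix.sum_mul, hK, one_mul]

theorem QuantumOperation.ofKraus_apply {m n : ℕ} {ρ : Type} [Fintype ρ]
    (K : ρ → Matrix (Fin n → Fin 2) (Fin m → Fin 2) ℂ) (hK : ∑ r, (K r)ᴴ * K r = 1)
    (A : QubitMatrix m) :
    (QuantumOperation.ofKraus K hK).apply A = ∑ r, K r * A * (K r)ᴴ := rfl

end Kraus

-- Recovery from orthogonal isometric branches

section Decoder

/-- If the deletion errors act on a code as a uniform mixture of isometries `(K c)ᴴ` with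
mutually orthogonal ranges, then some quantum operation undoes them. -/
theorem exists_decoder {m k : ℕ} {γ : Type} [Fintype γ] [DecidableEq γ]
    (K : γ → Matrix (Fin k → Fin 2) (Fin m → Fin 2) ℂ)
    (hK : ∀ c d, K c * (K d)ᴴ = if c = d then 1 else 0) :
    ∃ Φ : QuantumOperation m k, ∀ A : QubitMatrix k,
      Φ.apply (∑ c, (K c)ᴴ * A * K c) = (Fintype.card γ : ℂ) • A := by
  -- `S` is the orthogonal projection onto the sum of the ranges of the `(K c)ᴴ`.
  obtain ⟨S, hS⟩ : ∃ S : QubitMatrix m, S = ∑ c, (K c)ᴴ * K c := ⟨_, rfl⟩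
  have hSK : ∀ d, S * (K d)ᴴ = (K d)ᴴ := by
    intro d
    rw [hS, Matrix.sum_mul]
    rw [Finset.sum_eq_single d]
    · rw [Matrix.mul_assoc, hK, if_pos rfl, Matrix.mul_one]
    · intro c _ hc
      rw [Matrix.mul_assoc, hK, if_neg hc, Matrix.mul_zero]
    · simp
  have hSS : S * S = S := by
    conv_lhs => rw [hS, Matrix.mul_sum, ← hS]
    simp_rw [← Matrix.mul_assoc, hSK]
    exact hS.symm
  have hSH : Sᴴ = S := by
    rw [hS, Matrix.conjTranspose_sum]
    simp
  have hSum : ∑ s : Fin m → Fin 2, (Matrix.single (fun _ : Fin k => (0 : Fin 2)) s (1 : ℂ) *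
      (1 - S))ᴴ * (Matrix.single (fun _ : Fin k => (0 : Fin 2)) s (1 : ℂ) * (1 - S)) = 1 - S := by
    trans (1 - S)ᴴ * (∑ s : Fin m → Fin 2,
      (Matrix.single (fun _ : Fin k => (0 : Fin 2)) s (1 : ℂ))ᴴ *
        Matrix.single (fun _ : Fin k => (0 : Fin 2)) s (1 : ℂ)) * (1 - S)
    · simp only [Matrix.mul_sum, Matrix.sum_mul, Matrix.conjTranspose_mul, Matrix.mul_assoc]
    · rw [sum_conjTranspose_single_mul_single, Matrix.mul_one,
        Matrix.conjTranspose_sub, hSH, Matrix.conjTranspose_one, mul_sub, sub_mul, sub_mul, hSS]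
      simp
  -- The `K c` alone preserve trace only on the range of `S`; the extra operators send its
  -- complement to `|0…0⟩`.
  let R : γ ⊕ (Fin m → Fin 2) → Matrix (Fin k → Fin 2) (Fin m → Fin 2) ℂ :=
    Sum.elim K fun s =>
      Matrix.single (fun _ : Fin k => (0 : Fin 2)) s (1 : ℂ) * (1 - S)
  have hR : ∑ r, (R r)ᴴ * R r = 1 := by
    rw [Fintype.sum_sum_type]
    simp only [R, Sum.elim_inl, Sum.elim_inr, ← hS, hSum]
    exact add_sub_cancel S 1
  refine ⟨QuantumOperation.ofKraus R hR, fun A => ?_⟩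
  have hperp : ∀ s c, R (Sum.inr s) * (K c)ᴴ = 0 := by
    intro s c
    simp only [R, Sum.elim_inr]
    rw [Matrix.mul_assoc, Matrix.sub_mul, hSK, Matrix.one_mul, sub_self, Matrix.mul_zero]
  rw [QuantumOperation.ofKraus_apply, Fintype.sum_sum_type]
  have h1 : ∀ d, R (Sum.inl d) * (∑ c, (K c)ᴴ * A * K c) * (R (Sum.inl d))ᴴ = A := by
    intro d
    have : ∀ c, K d * ((K c)ᴴ * A * K c) * (K d)ᴴ = if d = c then A else 0 := by
      intro c
      rw [show K d * ((K c)ᴴ * A * K c) * (K d)ᴴ = (K d * (K c)ᴴ) * A * (K c * (K d)ᴴ) by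
        simp only [Matrix.mul_assoc], hK, hK]
      by_cases h : d = c
      · simp [h]
      · simp [h]
    simp only [R, Sum.elim_inl, Matrix.mul_sum, Matrix.sum_mul, this]
    simp
  have h2 : ∀ s, R (Sum.inr s) * (∑ c, (K c)ᴴ * A * K c) * (R (Sum.inr s))ᴴ = 0 := by
    intro s
    simp only [Matrix.mul_sum, ← Matrix.mul_assoc, hperp, Matrix.zero_mul, Finset.sum_const_zero]
  simp only [h1, h2, Finset.sum_const_zero, add_zero, Finset.sum_const, Finset.card_univ]
  module

end Decoder

-- The four-qubit code

section FourQubitCode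

/-- The number of ones in a binary sequence. -/
def hammingWeight {n : ℕ} (x : Fin n → Fin 2) : ℕ := ∑ j, (x j).val

theorem hammingWeight_insertNth {m : ℕ} (i : Fin (m + 1)) (c : Fin 2) (x : Fin m → Fin 2) :
    hammingWeight (i.insertNth c x : Fin (m + 1) → Fin 2) = c.val + hammingWeight x := by
  unfold hammingWeight
  rw [Fin.sum_univ_succAbove _ i]
  simp

/-- `√2` times the amplitude of the encoded basis state `z` on a basis state of weight `w`. -/
noncomputable def q4Amplitude (z : Fin 2) (w : ℕ) : ℝ :=
  if z = 0 then (if w = 0 ∨ w = 4 then 1 else 0) else (if w = 2 then (√3)⁻¹ else 0)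

theorem En4_apply (φ : Qubits 1) (x : Fin 4 → Fin 2) :
    En4 φ x = ((√2 : ℝ) : ℂ)⁻¹ * (φ ![0] * q4Amplitude 0 (hammingWeight x) +
      φ ![1] * q4Amplitude 1 (hammingWeight x)) := by
  have h6 : √6 = √2 * √3 := by rw [← Real.sqrt_mul (by norm_num)]; norm_num
  obtain ⟨a, b, c, d, rfl⟩ : ∃ a b c d, x = ![a, b, c, d] :=
    ⟨x 0, x 1, x 2, x 3, by funext j; fin_cases j <;> rfl⟩
  simp only [En4, LinearMap.coe_mk, AddHom.coe_mk, PiLp.add_apply, PiLp.smul_apply, ket,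
    PiLp.single_apply, smul_eq_mul, h6, q4Amplitude, hammingWeight, Fin.sum_univ_four]
  fin_cases a <;> fin_cases b <;> fin_cases c <;> fin_cases d <;>
    simp [div_eq_mul_inv, mul_comm, mul_assoc]

/-- The adjoint isometries of the four-qubit code: `(q4Kraus c)ᴴ` maps a state to the normalized
branch of its encoding in which the deleted qubit has the value `c`. -/
noncomputable def q4Kraus (c : Fin 2) : Matrix (Fin 1 → Fin 2) (Fin 3 → Fin 2) ℂ :=
  Matrix.of fun z x => (q4Amplitude (z 0) (c.val + hammingWeight x) : ℂ)

/-- The four branch vectors are supported on distinct weights: 0 and 2 for `c = 0`, 3 and 1 for `c =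
1`. Weights 1 and 2 have three strings each, whence the factor `1/√3`. -/
theorem q4Kraus_mul_conjTranspose (c d : Fin 2) :
    q4Kraus c * (q4Kraus d)ᴴ = if c = d then 1 else 0 := by
  have hsum : ∀ f : (Fin 3 → Fin 2) → ℂ, ∑ x, f x = ∑ a, ∑ b, ∑ c, f ![a, b, c] := by
    intro f
    rw [← (Fin.consEquiv fun _ => Fin 2).sum_comp, Fintype.sum_prod_type]
    refine Finset.sum_congr rfl fun a _ => ?_
    rw [← (finTwoArrowEquiv (Fin 2)).symm.sum_comp, Fintype.sum_prod_type]
    rfl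
  have h3 : ((√3 : ℝ) : ℂ)⁻¹ * ((√3 : ℝ) : ℂ)⁻¹ = 3⁻¹ := by
    rw [← mul_inv, ← Complex.ofReal_mul, Real.mul_self_sqrt (by norm_num)]
    norm_num
  ext z z'
  obtain ⟨s, rfl⟩ : ∃ s, z = ![s] := ⟨z 0, by funext j; fin_cases j; rfl⟩
  obtain ⟨t, rfl⟩ : ∃ t, z' = ![t] := ⟨z' 0, by funext j; fin_cases j; rfl⟩
  simp only [Matrix.mul_apply, Matrix.conjTranspose_apply, q4Kraus, Matrix.of_apply, hsum,
    Complex.star_def, Complex.conj_ofReal, hammingWeight, Fin.sum_univ_two, Fin.sum_univ_three,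
    q4Amplitude]
  fin_cases c <;> fin_cases d <;> fin_cases s <;> fin_cases t <;>
    simp [h3] <;> norm_num

/-- Inserting `c` anywhere raises the weight by `c`, so the right side is free of `i` and one
decoder serves all deletions. -/
theorem slice_En4 (i : Fin 4) (c : Fin 2) (φ : Qubits 1) :
    slice i c (En4 φ) = ((√2 : ℝ) : ℂ)⁻¹ • ((q4Kraus c)ᴴ *ᵥ ⇑φ) := by
  have hsum : ∀ f : (Fin 1 → Fin 2) → ℂ, ∑ z, f z = f ![0] + f ![1] := by
    intro f
    rw [← Fin.sum_univ_two fun b => f ![b], ← (Equiv.funUnique (Fin 1) (Fin 2)).symm.sum_comp]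
    refine Finset.sum_congr rfl fun b _ => congrArg f (funext fun j => ?_)
    fin_cases j
    rfl
  funext x
  rw [slice_apply, En4_apply, hammingWeight_insertNth]
  simp only [Pi.smul_apply, Matrix.mulVec, dotProduct, hsum, Matrix.conjTranspose_apply, q4Kraus,
    Matrix.of_apply, Complex.star_def, Complex.conj_ofReal, smul_eq_mul, Matrix.cons_val_zero]
  ring

theorem two_smul_deletion_En4 (i : Fin 4) (φ : Qubits 1) :
    (2 : ℂ) • deletion i (pureState (En4 φ)) =
      ∑ c, (q4Kraus c)ᴴ * pureState φ * q4Kraus c := by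
  have h2 : ((√2 : ℝ) : ℂ)⁻¹ * ((√2 : ℝ) : ℂ)⁻¹ = 2⁻¹ := by
    rw [← mul_inv, ← Complex.ofReal_mul, Real.mul_self_sqrt (by norm_num)]
    norm_num
  have hterm : ∀ c, (2 : ℂ) • vecMulVec (slice i c (En4 φ)) (star (slice i c (En4 φ))) =
      (q4Kraus c)ᴴ * pureState φ * q4Kraus c := by
    intro c
    rw [slice_En4, star_smul, Matrix.smul_vecMulVec, Matrix.vecMulVec_smul, smul_smul,
      Complex.star_def, map_inv₀, Complex.conj_ofReal, smul_smul, mul_assoc, h2, mul_inv_cancel₀ two_ne_zero,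
      one_smul, pureState_eq_vecMulVec, Matrix.mul_vecMulVec, Matrix.vecMulVec_mul,
      Matrix.star_mulVec, Matrix.conjTranspose_conjTranspose]
  rw [deletion_pureState, Finset.smul_sum]
  exact Finset.sum_congr rfl fun c _ => hterm c

theorem En4_injective : Function.Injective En4 := by
  rw [injective_iff_map_eq_zero]
  intro φ hφ
  have hx : ∀ x, En4 φ x = 0 := fun x => by rw [hφ]; rfl
  have h0 := hx ![0, 0, 0, 0]
  have h1 := hx ![0, 0, 1, 1]
  rw [En4_apply] at h0 h1
  simp [q4Amplitude, hammingWeight, Fin.sum_univ_four] at h0 h1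
  ext z
  obtain ⟨s, rfl⟩ : ∃ s, z = ![s] := ⟨z 0, by funext j; fin_cases j; rfl⟩
  fin_cases s
  · exact h0
  · exact h1

theorem isSingleDeletionCode_Q4 : IsSingleDeletionCode 4 1 Q4 := by
  obtain ⟨Φ, hΦ⟩ := exists_decoder q4Kraus q4Kraus_mul_conjTranspose
  refine ⟨LinearEquiv.ofInjective En4 En4_injective, Φ, fun φ _ i => ?_⟩
  change Φ.apply (deletion i (pureState (En4 φ))) = pureState φ
  have h := hΦ (pureState φ)
  rw [← two_smul_deletion_En4 i φ, ← QuantumOperation.toLinear_apply, map_smul,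
    Fintype.card_fin] at h
  exact smul_right_injective _ (two_ne_zero (α := ℂ)) (by exact_mod_cast h)

end FourQubitCode

theorem mainTheorem2 :
    (∀ (n k : ℕ) (Q : Submodule ℂ (Qubits n)),
      1 ≤ k → IsSingleDeletionCode n k Q → 4 ≤ n) ∧
    IsSingleDeletionCode 4 1 Q4 ∧
    IsLeast {n : ℕ | ∃ Q : Submodule ℂ (Qubits n), IsSingleDeletionCode n 1 Q} 4 := by
  refine ⟨fun n k Q hk h => h.four_le hk, isSingleDeletionCode_Q4,
    ⟨Q4, isSingleDeletionCode_Q4⟩, ?_⟩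
  rintro n ⟨Q, hQ⟩
  exact hQ.four_le le_rfl
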